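/- Work in ZFC. Let $\mathcal{E}$ be the $\sigma$-ideal on the Cantor space $2^\omega$ generated by the closed sets of measure zero (with respect to the standard product, i.e. fair coin-tossing, probability measure), so that $A\in\mathcal{E}$ if and only if $A\subseteq 2^\omega$ is covered by countably many closed null sets. Let \[ \mathcal{Z}=\Bigl\{A\subseteq\omega:\lim_{n\to\infty}\frac{|A\cap n|}{n}=0\Bigr\} \] be the asymptotic density zero ideal on $\omega$, where $n=\{0,\dots,n-1\}$. Define the cardinals \begin{align*} \operatorname{non}(\mathcal{E})&=\min\{|A|:A\subseteq 2^\omega,\ A\notin\mathcal{E}\},\\ \operatorname{cov}(\mathcal{E})&=\min\{|\mathcal{A}|:\mathcal{A}\subseteq\mathcal{E},\ \textstyle\bigcup\mathcal{A}=2^\omega\},\\ \operatorname{non}^*(\mathcal{Z})&=\min\{|\mathcal{A}|:\mathcal{A}\subseteq[\omega]^\omega,\ \forall B\in\mathcal{Z}\ \exists A\in\mathcal{A}\ (A\cap B\text{ is finite})\},\\ \operatorname{cov}^*(\mathcal{Z})&=\min\{|\mathcal{A}|:\mathcal{A}\subseteq\mathcal{Z},\ \forall B\in[\omega]^\omega\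 \exists A\in\mathcal{A}\ (A\cap B\text{ is infinite})\}, \end{align*} where $[\omega]^\omega$ is the set of infinite subsets of $\omega$. Then \[ \operatorname{non}(\mathcal{E})\leq\operatorname{non}^*(\mathcal{Z}),\qquad \operatorname{cov}^*(\mathcal{Z})\leq\operatorname{cov}(\mathcal{E}),\qquad \operatorname{cov}^*(\mathcal{Z})\leq\operatorname{non}^*(\mathcal{Z}). \] -/

import Mathlib

open Cardinal MeasureTheory Filter Topology

/-! ### Cardinal invariants of a `σ`-ideal -/

/-- `non(I)`: the least cardinality of a subset of `X` that does not belong to `I`. -/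
noncomputable def nonNumber {X : Type} (I : Set (Set X)) : Cardinal.{0} :=
  sInf {κ | ∃ A : Set X, A ∉ I ∧ #A = κ}

/-- `cov(I)`: the least cardinality of a subfamily of `I` that covers `X`. -/
noncomputable def covNumber {X : Type} (I : Set (Set X)) : Cardinal.{0} :=
  sInf {κ | ∃ 𝒜 : Set (Set X), 𝒜 ⊆ I ∧ ⋃₀ 𝒜 = Set.univ ∧ #𝒜 = κ}

/-! ### Star invariants of an ideal on a countable set -/

/-- `non*(I)`: the least cardinality of a family `𝒜` of infinite subsets of `X` such that every
member of `I` has finite intersection with some member of `𝒜` (for a proper ideal `I`). -/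
noncomputable def nonStar {X : Type} (I : Set (Set X)) : Cardinal.{0} :=
  sInf {κ | ∃ 𝒜 : Set (Set X), (∀ A ∈ 𝒜, A.Infinite) ∧
    (∀ B ∈ I, ∃ A ∈ 𝒜, (A ∩ B).Finite) ∧ #𝒜 = κ}

/-- `cov*(I)`: the least cardinality of a subfamily `𝒜` of `I` such that every infinite subset
of `X` has infinite intersection with some member of `𝒜` (for a tall ideal `I`). -/
noncomputable def covStar {X : Type} (I : Set (Set X)) : Cardinal.{0} :=
  sInf {κ | ∃ 𝒜 : Set (Set X), 𝒜 ⊆ I ∧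
    (∀ B : Set X, B.Infinite → ∃ A ∈ 𝒜, (A ∩ B).Infinite) ∧ #𝒜 = κ}

/-! ### The two ideals -/

/-- The fair coin-tossing measure on the Cantor space `2^ω`, that is, the product of countably
many copies of the uniform probability measure on `{0, 1}`. -/
noncomputable def coinMeasure : Measure (ℕ → Bool) :=
  Measure.infinitePi fun _ : ℕ => (PMF.uniformOfFintype Bool).toMeasure

/-- The `σ`-ideal `ℰ` on `2^ω` generated by the closed null sets: all sets that are covered by
countably many closed null sets. -/
def closedNullIdeal : Set (Set (ℕ → Bool)) :=
  {A | ∃ F : ℕ → Set (ℕ → Bool), (∀ n, IsClosed (F n) ∧ coinMeasure (F n) = 0) ∧ A ⊆ ⋃ n, F n}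

/-- The ideal `𝒵` of the sets of natural numbers of asymptotic density zero. -/
def densityZeroIdeal : Set (Set ℕ) :=
  {A | Tendsto (fun n : ℕ => ((A ∩ Set.Iio n).ncard : ℝ) / n) atTop (𝓝 0)}

/-! ### The minima in the four invariants are taken over nonempty sets -/

theorem exists_not_mem_closedNullIdeal : ∃ A, A ∉ closedNullIdeal := by
  refine ⟨Set.univ, ?_⟩
  rintro ⟨F, hF, hA⟩
  have : IsProbabilityMeasure coinMeasure := by unfold coinMeasure; infer_instance
  have h := measure_mono_null hA (measure_iUnion_null fun n => (hF n).2)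
  simp at h

theorem coinMeasure_singleton (x : ℕ → Bool) : coinMeasure {x} = 0 := by
  have h : ∀ n : ℕ, coinMeasure {x} ≤ (2⁻¹ : ENNReal) ^ n := by
    intro n
    calc coinMeasure {x} ≤ coinMeasure (Set.pi (Finset.range n) fun i => {x i}) :=
          measure_mono (by rintro y rfl i _; rfl)
      _ = (2⁻¹ : ENNReal) ^ n := by
          unfold coinMeasure
          rw [Measure.infinitePi_pi _ (fun i _ => measurableSet_singleton _)]
          simp
  refine le_antisymm (ge_of_tendsto' (ENNReal.tendsto_pow_atTop_nhds_zero_of_lt_one ?_) h)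
    zero_le
  simp

theorem exists_cover_closedNullIdeal :
    ∃ 𝒜 : Set (Set (ℕ → Bool)), 𝒜 ⊆ closedNullIdeal ∧ ⋃₀ 𝒜 = Set.univ := by
  refine ⟨Set.range fun x => {x}, ?_, ?_⟩
  · rintro _ ⟨x, rfl⟩
    exact ⟨fun _ => {x}, fun _ => ⟨isClosed_singleton, coinMeasure_singleton x⟩,
      fun y hy => Set.mem_iUnion.2 ⟨0, hy⟩⟩
  · ext x
    simp

theorem compl_infinite_of_mem_densityZeroIdeal {B : Set ℕ} (hB : B ∈ densityZeroIdeal) :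
    Bᶜ.Infinite := by
  intro hfin
  obtain ⟨m, hm⟩ := hfin.bddAbove
  have hB' : Tendsto (fun n : ℕ => ((B ∩ Set.Iio n).ncard : ℝ) / n) atTop (𝓝 0) := hB
  have hlow : ∀ᶠ n : ℕ in atTop, (1 / 2 : ℝ) ≤ ((B ∩ Set.Iio n).ncard : ℝ) / n := by
    filter_upwards [eventually_ge_atTop (2 * (m + 1))] with n hn
    have hsub : Set.Ico (m + 1) n ⊆ B ∩ Set.Iio n := by
      rintro k ⟨hk, hkn⟩
      refine ⟨?_, hkn⟩
      by_contra hkB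
      have := hm hkB
      omega
    have hcard := Set.ncard_le_ncard hsub ((Set.finite_Iio n).inter_of_right B)
    have hico : (Set.Ico (m + 1) n).ncard = n - (m + 1) := by
      rw [← Finset.coe_Ico, Set.ncard_coe_finset, Nat.card_Ico]
    have hnat : n ≤ 2 * (B ∩ Set.Iio n).ncard := by omega
    have hreal : (n : ℝ) ≤ 2 * ((B ∩ Set.Iio n).ncard : ℝ) := by exact_mod_cast hnat
    have hpos : (0 : ℝ) < n := by exact_mod_cast (by omega : 0 < n)
    rw [le_div_iff₀ hpos]
    linarith
  have := ge_of_tendsto hB' hlow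
  norm_num at this

theorem exists_nonStar_witness : ∃ 𝒜 : Set (Set ℕ), (∀ A ∈ 𝒜, A.Infinite) ∧
    ∀ B ∈ densityZeroIdeal, ∃ A ∈ 𝒜, (A ∩ B).Finite :=
  ⟨{A | A.Infinite}, fun _ h => h,
    fun B hB => ⟨Bᶜ, compl_infinite_of_mem_densityZeroIdeal hB, by simp⟩⟩

theorem exists_infinite_subset_mem_densityZeroIdeal {B : Set ℕ} (hB : B.Infinite) :
    ∃ A ∈ densityZeroIdeal, A ⊆ B ∧ A.Infinite := by
  have hmono := Nat.nth_strictMono (p := (· ∈ B)) hB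
  have hsq : StrictMono fun k : ℕ => Nat.nth (· ∈ B) (k ^ 2) :=
    hmono.comp (Nat.pow_left_strictMono two_ne_zero)
  refine ⟨Set.range fun k : ℕ => Nat.nth (· ∈ B) (k ^ 2), ?_, ?_, ?_⟩
  · have hcard : ∀ n : ℕ, ((Set.range fun k : ℕ => Nat.nth (· ∈ B) (k ^ 2)) ∩
        Set.Iio n).ncard ≤ Nat.sqrt n + 1 := by
      intro n
      have hsub : (Set.range fun k : ℕ => Nat.nth (· ∈ B) (k ^ 2)) ∩ Set.Iio n ⊆
          (((Finset.range (Nat.sqrt n + 1)).image fun k => Nat.nth (· ∈ B) (k ^ 2) :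
            Finset ℕ) : Set ℕ) := by
        rintro _ ⟨⟨k, rfl⟩, hk⟩
        have h1 : k ^ 2 ≤ Nat.nth (· ∈ B) (k ^ 2) := hmono.le_apply
        have h2 : k ≤ Nat.sqrt n := Nat.le_sqrt'.2 (h1.trans (le_of_lt hk))
        simp only [Finset.coe_image, Finset.coe_range]
        exact ⟨k, Nat.lt_succ_of_le h2, rfl⟩
      refine (Set.ncard_le_ncard hsub (Finset.finite_toSet _)).trans ?_
      rw [Set.ncard_coe_finset]
      exact Finset.card_image_le.trans (by simp)
    have hlim : Tendsto (fun n : ℕ => 1 / Real.sqrt n + 1 / (n : ℝ)) atTop (𝓝 0) := by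
      have h1 : Tendsto (fun n : ℕ => 1 / Real.sqrt n) atTop (𝓝 0) := by
        simp only [one_div]
        exact tendsto_inv_atTop_zero.comp
          (Real.tendsto_sqrt_atTop.comp tendsto_natCast_atTop_atTop)
      simpa using h1.add tendsto_one_div_atTop_nhds_zero_nat
    refine squeeze_zero (fun n => by positivity) (fun n => ?_) hlim
    have h1 : (((Set.range fun k : ℕ => Nat.nth (· ∈ B) (k ^ 2)) ∩ Set.Iio n).ncard : ℝ) ≤
        Real.sqrt n + 1 := by
      refine le_trans (by exact_mod_cast hcard n) (?_ : ((Nat.sqrt n : ℝ) + 1) ≤ _)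
      linarith [Real.nat_sqrt_le_real_sqrt (a := n)]
    calc _ ≤ (Real.sqrt n + 1) / (n : ℝ) := by gcongr
      _ = _ := by rw [add_div, Real.sqrt_div_self']
  · rintro _ ⟨k, rfl⟩
    exact Nat.nth_mem_of_infinite (p := (· ∈ B)) hB _
  · exact Set.infinite_range_of_injective hsq.injective

theorem exists_covStar_witness : ∃ 𝒜 : Set (Set ℕ), 𝒜 ⊆ densityZeroIdeal ∧
    ∀ B : Set ℕ, B.Infinite → ∃ A ∈ 𝒜, (A ∩ B).Infinite := by
  refine ⟨densityZeroIdeal, subset_rfl, fun B hB => ?_⟩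
  obtain ⟨A, hA, hAB, hinf⟩ := exists_infinite_subset_mem_densityZeroIdeal hB
  exact ⟨A, hA, by rwa [Set.inter_eq_left.2 hAB]⟩

/-! Read numbers in binary. By compactness every infinite set contains a sequence `a` such that,
below its leading bit, each `a (k + 1)` is an initial piece of a fixed `y` followed by a piece of a
fixed `x` (`ConvergentSeq`). Two points of `2^ω` thus describe the set, up to where the cuts fall.

For `C ∈ ℰ` there are consecutive intervals of coordinates on which the closed null sets covering
`C` leave ever fewer patterns. Below the leading bit of `a (k + 1)` lie two complete intervals, and
the cut spares one of them. So, if `x, y ∈ C`, one density zero set contains almost all terms,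
wherever the cuts are (`exists_mem_densityZeroIdeal_of_mem_closedNullIdeal`). This gives the first
two inequalities.

For the third, a witness for `non*(𝒵)` supplies both a set `X ∉ ℰ` and an unbounded family of growth
functions (`exists_mem_densityZeroIdeal_of_growth`). A point `z ∈ X` guesses low digits of
infinitely many terms of a given sequence, arbitrarily many at a time; a growth function `h` sets
how many guesses must be right. The sets `guessSet h z` then witness `cov*(𝒵)`. -/

/-! ### Density zero through dyadic blocks and binary digits -/

theorem mem_densityZeroIdeal_of_dyadic {S : Set ℕ}
    (h : ∀ K : ℕ, ∀ᶠ n in atTop, (S ∩ Set.Ico (2 ^ n) (2 ^ (n + 1))).ncard * 2 ^ K ≤ 2 ^ n) :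
    S ∈ densityZeroIdeal := by
  -- The constant term pays for the blocks below `n₀`; the factor 2 comes from rounding `N` up to a
  -- power of two.
  have key : ∀ K : ℕ, ∃ n₀ : ℕ, ∀ N : ℕ, 2 ^ n₀ ≤ N →
      (S ∩ Set.Iio N).ncard * 2 ^ K ≤ 2 ^ (n₀ + K) + 2 * N := by
    intro K
    obtain ⟨n₀, hn₀⟩ := eventually_atTop.1 (h K)
    have hpow : ∀ n, n₀ ≤ n → (S ∩ Set.Iio (2 ^ n)).ncard * 2 ^ K ≤ 2 ^ (n₀ + K) + 2 ^ n := by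
      intro n hn
      induction n, hn using Nat.le_induction with
      | base =>
        have h1 : (S ∩ Set.Iio (2 ^ n₀)).ncard ≤ 2 ^ n₀ := by
          have := Set.ncard_le_ncard (Set.inter_subset_right (s := S) (t := Set.Iio (2 ^ n₀)))
            (Set.finite_Iio _)
          rwa [← Finset.coe_Iio, Set.ncard_coe_finset, Nat.card_Iio, Finset.coe_Iio] at this
        have := Nat.mul_le_mul_right (2 ^ K) h1
        rw [← pow_add] at this
        omega
      | succ n hn ih =>
        have hsub : S ∩ Set.Iio (2 ^ (n + 1)) ⊆
            (S ∩ Set.Iio (2 ^ n)) ∪ (S ∩ Set.Ico (2 ^ n) (2 ^ (n + 1))) := by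
          rintro a ⟨ha, ha'⟩
          rcases lt_or_ge a (2 ^ n) with h1 | h1
          · exact Or.inl ⟨ha, h1⟩
          · exact Or.inr ⟨ha, h1, ha'⟩
        have h1 := (Set.ncard_le_ncard hsub (((Set.finite_Iio _).inter_of_right _).union
          ((Set.finite_Ico _ _).inter_of_right _))).trans (Set.ncard_union_le _ _)
        have h2 := Nat.mul_le_mul_right (2 ^ K) h1
        have h3 := hn₀ n hn
        rw [add_mul] at h2
        rw [pow_succ 2 n] at *
        omega
    refine ⟨n₀, fun N hN => ?_⟩
    have hN0 : N ≠ 0 := by have := Nat.two_pow_pos n₀; omega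
    have h1 : n₀ ≤ Nat.log 2 N + 1 := (Nat.le_log_of_pow_le one_lt_two hN).trans (Nat.le_succ _)
    have h2 : N < 2 ^ (Nat.log 2 N + 1) := Nat.lt_pow_succ_log_self one_lt_two N
    have h3 : 2 ^ Nat.log 2 N ≤ N := Nat.pow_log_le_self 2 hN0
    have h4 := Set.ncard_le_ncard (Set.inter_subset_inter_right S (Set.Iio_subset_Iio h2.le))
      ((Set.finite_Iio _).inter_of_right _)
    have h5 := (Nat.mul_le_mul_right (2 ^ K) h4).trans (hpow _ h1)
    rw [pow_succ 2 (Nat.log 2 N)] at h5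
    omega
  refine Metric.tendsto_atTop.2 fun ε hε => ?_
  obtain ⟨K, hK⟩ := exists_pow_lt_of_lt_one (half_pos (half_pos hε)) (one_half_lt_one (α := ℝ))
  obtain ⟨n₀, hn₀⟩ := key K
  obtain ⟨M, hM⟩ := exists_nat_gt ((2 : ℝ) ^ n₀ / (ε / 2))
  refine ⟨max (2 ^ n₀) M, fun N hN => ?_⟩
  have h1 := hn₀ N (le_of_max_le_left hN)
  have hNM : (M : ℝ) ≤ N := by exact_mod_cast le_of_max_le_right hN
  have hNpos : (0 : ℝ) < N := by
    have : 0 < N := (Nat.two_pow_pos n₀).trans_le (le_of_max_le_left hN)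
    exact_mod_cast this
  have h2 : ((S ∩ Set.Iio N).ncard : ℝ) * 2 ^ K ≤ 2 ^ n₀ * 2 ^ K + 2 * N := by
    rw [← pow_add]; exact_mod_cast h1
  have h3 : (2 : ℝ) ^ n₀ < ε / 2 * N := by
    have := (div_lt_iff₀ (half_pos hε)).1 (hM.trans_le hNM)
    linarith
  have hKpos : (0 : ℝ) < 2 ^ K := by positivity
  have h4 : 1 < ε / 2 / 2 * 2 ^ K := by
    rw [one_div, inv_pow] at hK
    exact (inv_lt_iff_one_lt_mul₀ hKpos).1 hK
  rw [Real.dist_eq, sub_zero, abs_of_nonneg (by positivity), div_lt_iff₀ hNpos]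
  refine lt_of_mul_lt_mul_right (h2.trans_lt ?_) hKpos.le
  nlinarith [mul_lt_mul_of_pos_right h3 hKpos, mul_lt_mul_of_pos_right h4 hNpos]

/-- A set of numbers determined by the last `l` binary digits has the same relative size in
`[2 ^ n, 2 ^ (n + 1))` as among the residues. -/
theorem ncard_dyadic_mul_le {P : ℕ → Prop} {l n K : ℕ} (hln : l ≤ n)
    (hP : {r | r < 2 ^ l ∧ P r}.ncard * 2 ^ K ≤ 2 ^ l) {S : Set ℕ}
    (hS : ∀ a ∈ S, 2 ^ n ≤ a → a < 2 ^ (n + 1) → P (a % 2 ^ l)) :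
    (S ∩ Set.Ico (2 ^ n) (2 ^ (n + 1))).ncard * 2 ^ K ≤ 2 ^ n := by
  have hfin : {r | r < 2 ^ l ∧ P r}.Finite := (Set.finite_Iio (2 ^ l)).subset fun r hr => hr.1
  have hpos : 0 < 2 ^ l := Nat.two_pow_pos l
  obtain ⟨e, rfl⟩ := Nat.exists_eq_add_of_le hln
  have hcard : (S ∩ Set.Ico (2 ^ (l + e)) (2 ^ (l + e + 1))).ncard ≤
      (Set.Ico (2 ^ e) (2 ^ (e + 1)) ×ˢ {r | r < 2 ^ l ∧ P r}).ncard := by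
    refine Set.ncard_le_ncard_of_injOn (fun a => (a / 2 ^ l, a % 2 ^ l)) ?_ ?_
      ((Set.finite_Ico _ _).prod hfin)
    · rintro a ⟨ha, h1, h2⟩
      refine ⟨⟨(Nat.le_div_iff_mul_le hpos).2 ?_, (Nat.div_lt_iff_lt_mul hpos).2 ?_⟩,
        Nat.mod_lt _ hpos, hS a ha h1 h2⟩
      · rwa [← pow_add, add_comm]
      · rwa [← pow_add, add_right_comm, add_comm e l]
    · intro a _ b _ hab
      simp only [Prod.mk.injEq] at hab
      rw [← Nat.div_add_mod a (2 ^ l), ← Nat.div_add_mod b (2 ^ l), hab.1, hab.2]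
  have hIco : (Set.Ico (2 ^ e) (2 ^ (e + 1))).ncard = 2 ^ e := by
    rw [← Finset.coe_Ico, Set.ncard_coe_finset, Nat.card_Ico, pow_succ, Nat.mul_two,
      Nat.add_sub_cancel]
  rw [Set.ncard_prod, hIco] at hcard
  calc _ ≤ (2 ^ e * {r | r < 2 ^ l ∧ P r}.ncard) * 2 ^ K := Nat.mul_le_mul_right _ hcard
    _ = 2 ^ e * ({r | r < 2 ^ l ∧ P r}.ncard * 2 ^ K) := mul_assoc _ _ _
    _ ≤ 2 ^ e * 2 ^ l := Nat.mul_le_mul_left _ hP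
    _ = 2 ^ (l + e) := by rw [← pow_add, add_comm]

theorem eq_of_testBit_eq_of_lt {r s n : ℕ} (hr : r < 2 ^ n) (hs : s < 2 ^ n)
    (h : ∀ j < n, r.testBit j = s.testBit j) : r = s := by
  refine Nat.eq_of_testBit_eq fun j => ?_
  rcases lt_or_ge j n with hj | hj
  · exact h j hj
  · rw [Nat.testBit_lt_two_pow (hr.trans_le (Nat.pow_le_pow_right two_pos hj)),
      Nat.testBit_lt_two_pow (hs.trans_le (Nat.pow_le_pow_right two_pos hj))]

theorem ncard_dyadic_testBit_le {S : Set ℕ} {n K : ℕ} (hKn : K ≤ n) (c : ℕ → Bool)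
    (hS : ∀ a ∈ S, Nat.log 2 a = n → ∀ j < K, a.testBit j = c j) :
    (S ∩ Set.Ico (2 ^ n) (2 ^ (n + 1))).ncard * 2 ^ K ≤ 2 ^ n := by
  refine ncard_dyadic_mul_le (P := fun r => ∀ j < K, r.testBit j = c j) hKn ?_ ?_
  · have hsub : {r | r < 2 ^ K ∧ ∀ j < K, r.testBit j = c j}.Subsingleton := by
      rintro r ⟨hr, h1⟩ s ⟨hs, h2⟩
      exact eq_of_testBit_eq_of_lt hr hs fun j hj => (h1 j hj).trans (h2 j hj).symm
    have h1 := (Set.ncard_le_one hsub.finite).2 fun a ha b hb => hsub ha hb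
    nlinarith [Nat.two_pow_pos K]
  · intro a ha h1 h2 j hj
    rw [Nat.testBit_mod_two_pow, hS a ha (Nat.log_eq_of_pow_le_of_lt_pow h1 h2) j hj]
    simp [hj]

theorem log_eq_of_mem_Ico {a n : ℕ} (h : a ∈ Set.Ico (2 ^ n) (2 ^ (n + 1))) : Nat.log 2 a = n :=
  Nat.log_eq_of_pow_le_of_lt_pow h.1 h.2

theorem StrictMono.exists_le_lt_succ {I : ℕ → ℕ} (hI : StrictMono I) {n : ℕ} (h0 : I 0 ≤ n) :
    ∃ m, I m ≤ n ∧ n < I (m + 1) := by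
  have hfind : ∃ m, n < I (m + 1) :=
    ⟨n, (Nat.lt_succ_self n).trans_le (hI.le_apply (x := n + 1))⟩
  classical
  refine ⟨Nat.find hfind, ?_, Nat.find_spec hfind⟩
  rcases h : Nat.find hfind with _ | m
  · exact h0
  · exact not_lt.1 (Nat.find_min hfind (m := m) (by omega))

/-! ### Two-adically convergent sequences -/

/-- The sequence `a` converges in the `2`-adic sense to `y`: the binary digits of `a (k + 1)` below
`log₂ (a k)` agree with `y`, and its remaining digits are recorded by `x`. -/
structure ConvergentSeq (a : ℕ → ℕ) (x y : ℕ → Bool) : Prop where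
  strictMono : StrictMono fun k => Nat.log 2 (a k)
  eq_limit : ∀ k j, j < Nat.log 2 (a k) → (a (k + 1)).testBit j = y j
  eq_tail : ∀ k j, Nat.log 2 (a k) ≤ j → j < Nat.log 2 (a (k + 1)) → (a (k + 1)).testBit j = x j

/-- The digit sequences of the elements of `A` have a cluster point `y` in the compact space `2^ω`.
Choosing each term beyond the length of its predecessor makes the tail blocks disjoint, so a single
`x` records them all. -/
theorem Set.Infinite.exists_convergentSeq {A : Set ℕ} (hA : A.Infinite) :
    ∃ a x y, (∀ k, a k ∈ A) ∧ ConvergentSeq a x y := by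
  have : (cofinite ⊓ 𝓟 A).NeBot := Filter.cofinite_inf_principal_neBot_iff.2 hA
  obtain ⟨y, hy⟩ := exists_clusterPt_of_compactSpace
    (map (fun a : ℕ => fun j => a.testBit j) (cofinite ⊓ 𝓟 A))
  have hnext : ∀ N : ℕ, ∃ a ∈ A, N < Nat.log 2 a ∧ ∀ j < N, a.testBit j = y j := by
    intro N
    have hU : {z : ℕ → Bool | ∀ j ∈ Set.Iio N, z j = y j} ∈ 𝓝 y := by
      have : IsOpen (Set.pi (Set.Iio N) fun j => ({y j} : Set Bool)) :=
        isOpen_set_pi (Set.finite_Iio N) fun _ _ => isOpen_discrete _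
      exact this.mem_nhds fun _ _ => rfl
    have h1 := (mapClusterPt_iff_frequently.1 hy _ hU)
    have h2 : ∀ᶠ a in cofinite ⊓ 𝓟 A, a ∈ A ∧ 2 ^ (N + 1) ≤ a := by
      refine (eventually_inf_principal.2 (Eventually.of_forall fun a h => h)).and ?_
      refine Eventually.filter_mono inf_le_left ?_
      rw [Nat.cofinite_eq_atTop]
      exact eventually_ge_atTop _
    obtain ⟨a, h3, h4, h5⟩ := (h1.and_eventually h2).exists
    exact ⟨a, h4, Nat.le_log_of_pow_le one_lt_two h5, h3⟩
  choose next hmem hlog hbit using hnext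
  let a : ℕ → ℕ := fun k => Nat.rec (next 0) (fun _ b => next (Nat.log 2 b)) k
  have ha : ∀ k, a (k + 1) = next (Nat.log 2 (a k)) := fun _ => rfl
  have hmono : StrictMono fun k => Nat.log 2 (a k) :=
    strictMono_nat_of_lt_succ fun k => by rw [ha]; exact hlog _
  have hex : ∀ j, ∃ k, j < Nat.log 2 (a k) := fun j =>
    ⟨j + 1, (Nat.lt_succ_self j).trans_le (hmono.le_apply (x := j + 1))⟩
  classical
  refine ⟨a, fun j => (a (Nat.find (hex j))).testBit j, y, ?_, hmono, ?_, ?_⟩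
  · rintro (_ | k)
    · exact hmem 0
    · exact hmem _
  · intro k j hj
    rw [ha]
    exact hbit _ j hj
  · intro k j h1 h2
    have : Nat.find (hex j) = k + 1 := (Nat.find_eq_iff _).2 ⟨h2, fun i hi =>
      not_lt.2 ((hmono.monotone (Nat.lt_succ_iff.1 hi)).trans h1)⟩
    rw [this]

/-! ### Counting digit patterns of closed null sets -/

instance isProbabilityMeasure_coinMeasure : IsProbabilityMeasure coinMeasure := by
  unfold coinMeasure; infer_instance

theorem coinMeasure_pi_singleton (T : Finset ℕ) (c : ℕ → Bool) :
    coinMeasure (Set.pi T fun p => {c p}) = (2⁻¹ : ENNReal) ^ T.card := by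
  unfold coinMeasure
  rw [Measure.infinitePi_pi _ (fun i _ => measurableSet_singleton _)]
  simp

theorem isOpen_pi_singleton (T : Finset ℕ) (c : ℕ → Bool) :
    IsOpen (Set.pi (T : Set ℕ) fun p => ({c p} : Set Bool)) :=
  isOpen_set_pi T.finite_toSet fun _ _ => isOpen_discrete _

theorem exists_testBit_eq (w : ℕ → Bool) (n : ℕ) : ∃ r < 2 ^ n, ∀ j < n, r.testBit j = w j :=
  ⟨Nat.ofBits fun j : Fin n => w j, Nat.ofBits_lt_two_pow _,
    fun j hj => Nat.testBit_ofBits_lt (fun j : Fin n => w j) j hj⟩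

/-- Closedness makes `F` the decreasing intersection of its cylinder neighbourhoods, and the measure
is continuous from above. -/
theorem tendsto_coinMeasure_cylinder {F : Set (ℕ → Bool)} (hF : IsClosed F)
    (h0 : coinMeasure F = 0) :
    Tendsto (fun n => coinMeasure {z | ∃ w ∈ F, ∀ j < n, w j = z j}) atTop (𝓝 0) := by
  have hinter : ⋂ n : ℕ, {z | ∃ w ∈ F, ∀ j < n, w j = z j} = F := by
    refine Set.Subset.antisymm (fun z hz => ?_) fun z hz =>
      Set.mem_iInter.2 fun n => ⟨z, hz, fun _ _ => rfl⟩
    choose w hwF hw using Set.mem_iInter.1 hz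
    refine hF.mem_of_tendsto (tendsto_pi_nhds.2 fun j => ?_) (Eventually.of_forall hwF)
      (b := atTop)
    refine tendsto_const_nhds.congr' ?_
    filter_upwards [eventually_gt_atTop j] with n hn
    exact (hw n j hn).symm
  have hopen : ∀ n : ℕ, IsOpen {z : ℕ → Bool | ∃ w ∈ F, ∀ j < n, w j = z j} := by
    intro n
    have : {z : ℕ → Bool | ∃ w ∈ F, ∀ j < n, w j = z j} =
        ⋃ w ∈ F, Set.pi (Finset.range n : Set ℕ) fun p => {w p} := by
      ext z
      simp [eq_comm]
    rw [this]
    exact isOpen_biUnion fun w _ => isOpen_pi_singleton _ w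
  rw [← h0]
  conv => enter [3, 1]; rw [← hinter]
  refine tendsto_measure_iInter_atTop (fun n => (hopen n).measurableSet.nullMeasurableSet) ?_
    ⟨0, measure_ne_top _ _⟩
  rintro m n hmn z ⟨w, hw, h⟩
  exact ⟨w, hw, fun j hj => h j (hj.trans_le hmn)⟩

theorem ncard_cylinder_le (F : Set (ℕ → Bool)) (n : ℕ) :
    ({r | r < 2 ^ n ∧ ∃ w ∈ F, ∀ j < n, w j = r.testBit j}.ncard : ENNReal) * 2⁻¹ ^ n ≤
      coinMeasure {z | ∃ w ∈ F, ∀ j < n, w j = z j} := by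
  set U := {r | r < 2 ^ n ∧ ∃ w ∈ F, ∀ j < n, w j = r.testBit j} with hU
  have hfin : U.Finite := (Set.finite_Iio (2 ^ n)).subset fun r hr => hr.1
  let cyl : ℕ → Set (ℕ → Bool) := fun r => Set.pi (Finset.range n : Set ℕ) fun j => {r.testBit j}
  have hdisj : Set.PairwiseDisjoint (hfin.toFinset : Set ℕ) cyl := by
    intro r hr s hs hrs
    refine Set.disjoint_left.2 fun z hz hz' => hrs ?_
    rw [hfin.coe_toFinset] at hr hs
    refine eq_of_testBit_eq_of_lt hr.1 hs.1 fun j hj => ?_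
    exact (hz j (by simpa using hj)).symm.trans (hz' j (by simpa using hj))
  calc (U.ncard : ENNReal) * 2⁻¹ ^ n = ∑ r ∈ hfin.toFinset, coinMeasure (cyl r) := by
        rw [Finset.sum_congr rfl fun r _ => coinMeasure_pi_singleton (Finset.range n) _]
        rw [Set.ncard_eq_toFinset_card _ hfin]
        simp
    _ = coinMeasure (⋃ r ∈ hfin.toFinset, cyl r) :=
        (measure_biUnion_finset hdisj fun r _ => (isOpen_pi_singleton _ _).measurableSet).symm
    _ ≤ _ := by
        refine measure_mono (Set.iUnion₂_subset fun r hr z hz => ?_)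
        obtain ⟨-, w, hw, h⟩ := hfin.mem_toFinset.1 hr
        exact ⟨w, hw, fun j hj => (h j hj).trans (hz j (by simpa using hj)).symm⟩

theorem eventually_ncard_cylinder_mul_le {F : Set (ℕ → Bool)} (hF : IsClosed F)
    (h0 : coinMeasure F = 0) (K : ℕ) : ∀ᶠ n in atTop,
      {r | r < 2 ^ n ∧ ∃ w ∈ F, ∀ j < n, w j = r.testBit j}.ncard * 2 ^ K ≤ 2 ^ n := by
  have hpos : (0 : ENNReal) < 2⁻¹ ^ K := ENNReal.pow_pos (by simp) K
  filter_upwards [(tendsto_coinMeasure_cylinder hF h0).eventually_lt_const hpos] with n hn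
  have h1 := (ncard_cylinder_le F n).trans hn.le
  rw [← ENNReal.inv_pow, ← ENNReal.inv_pow, ← div_eq_mul_inv,
    ENNReal.div_le_iff (by simp) (by simp), mul_comm, ← div_eq_mul_inv,
    ENNReal.le_div_iff_mul_le (by simp) (by simp)] at h1
  exact_mod_cast h1

/-- A closed null set stays small on intervals of coordinates that are long enough. -/
theorem exists_ncard_interval_mul_le {F : Set (ℕ → Bool)} (hF : IsClosed F)
    (h0 : coinMeasure F = 0) (i K : ℕ) : ∃ n, i < n ∧
      {r | r < 2 ^ n ∧ ∃ w ∈ F, ∀ j, i ≤ j → j < n → w j = r.testBit j}.ncard * 2 ^ K ≤ 2 ^ n := by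
  -- Forgetting the first `i` digits multiplies the count by at most `2 ^ i`, hence the exponent `i
  -- + K`.
  obtain ⟨n, h1, hin⟩ := ((eventually_ncard_cylinder_mul_le hF h0 (i + K)).and
    (eventually_gt_atTop i)).exists
  refine ⟨n, hin, ?_⟩
  set U := {r | r < 2 ^ n ∧ ∃ w ∈ F, ∀ j < n, w j = r.testBit j}
  have hfin : U.Finite := (Set.finite_Iio (2 ^ n)).subset fun r hr => hr.1
  have hcard : {r | r < 2 ^ n ∧ ∃ w ∈ F, ∀ j, i ≤ j → j < n → w j = r.testBit j}.ncard ≤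
      (Set.Iio (2 ^ i) ×ˢ U).ncard := by
    have hex : ∀ r : ℕ, ∃ u : ℕ, (r < 2 ^ n ∧ ∃ w ∈ F, ∀ j, i ≤ j → j < n → w j = r.testBit j) →
        u ∈ U ∧ ∀ j, i ≤ j → j < n → u.testBit j = r.testBit j := by
      intro r
      by_cases hr : r < 2 ^ n ∧ ∃ w ∈ F, ∀ j, i ≤ j → j < n → w j = r.testBit j
      · obtain ⟨-, w, hw, h⟩ := hr
        obtain ⟨u, hu, huw⟩ := exists_testBit_eq w n
        exact ⟨u, fun _ => ⟨⟨hu, w, hw, fun j hj => (huw j hj).symm⟩,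
          fun j h1 h2 => (huw j h2).trans (h j h1 h2)⟩⟩
      · exact ⟨0, fun h => absurd h hr⟩
    choose u hu using hex
    refine Set.ncard_le_ncard_of_injOn (fun r => (r % 2 ^ i, u r)) ?_ ?_
      ((Set.finite_Iio _).prod hfin)
    · intro r hr
      exact ⟨Nat.mod_lt _ (Nat.two_pow_pos i), (hu r hr).1⟩
    · intro r hr s hs hrs
      simp only [Prod.mk.injEq] at hrs
      refine eq_of_testBit_eq_of_lt hr.1 hs.1 fun j hj => ?_
      rcases lt_or_ge j i with hji | hji
      · have := congrArg (fun t => Nat.testBit t j) hrs.1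
        simpa [Nat.testBit_mod_two_pow, hji] using this
      · rw [← (hu r hr).2 j hji hj, ← (hu s hs).2 j hji hj, hrs.2]
  have hIio : (Set.Iio (2 ^ i)).ncard = 2 ^ i := by
    rw [← Finset.coe_Iio, Set.ncard_coe_finset, Nat.card_Iio]
  rw [Set.ncard_prod, hIio] at hcard
  calc _ ≤ (2 ^ i * U.ncard) * 2 ^ K := Nat.mul_le_mul_right _ hcard
    _ = U.ncard * 2 ^ (i + K) := by rw [pow_add]; ring
    _ ≤ 2 ^ n := h1

/-! ### Catching sequences whose digits lie in a set of the ideal -/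

/-- A set covered by countably many closed null sets is caught by a density zero set along every
convergent sequence both of whose digit sequences lie in it. -/
theorem exists_mem_densityZeroIdeal_of_mem_closedNullIdeal {C : Set (ℕ → Bool)}
    (hC : C ∈ closedNullIdeal) : ∃ Z ∈ densityZeroIdeal, ∀ a x y, ConvergentSeq a x y →
      x ∈ C → y ∈ C → ∀ᶠ k in atTop, a (k + 1) ∈ Z := by
  obtain ⟨F, hF, hCF⟩ := hC
  -- Finite unions make the sets increase, so a point of `C` lies in all but finitely many of them.
  have hFm : ∀ m, IsClosed (⋃ l ∈ Set.Iic m, F l) ∧ coinMeasure (⋃ l ∈ Set.Iic m, F l) = 0 :=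
    fun m => ⟨(Set.finite_Iic m).isClosed_biUnion fun l _ => (hF l).1,
      (measure_biUnion_null_iff (Set.finite_Iic m).countable).2 fun l _ => (hF l).2⟩
  have hex : ∀ m i, ∃ n, i < n ∧ {r | r < 2 ^ n ∧ ∃ w ∈ ⋃ l ∈ Set.Iic m, F l,
      ∀ j, i ≤ j → j < n → w j = r.testBit j}.ncard * 2 ^ m ≤ 2 ^ n :=
    fun m i => exists_ncard_interval_mul_le (hFm m).1 (hFm m).2 i m
  choose next hnext hsmall using hex
  obtain ⟨I, hIsucc⟩ : ∃ I : ℕ → ℕ, ∀ m, I (m + 1) = next m (I m) :=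
    ⟨fun m => Nat.rec 0 next m, fun _ => rfl⟩
  have hI : StrictMono I := strictMono_nat_of_lt_succ fun m => hIsucc m ▸ hnext m (I m)
  have hIle : ∀ p q, p ≤ q → I p ≤ I q := fun _ _ h => hI.monotone h
  let P : ℕ → ℕ → Prop := fun m r => ∃ w ∈ ⋃ l ∈ Set.Iic m, F l,
    ∀ j, I m ≤ j → j < I (m + 1) → w j = r.testBit j
  have hPsmall : ∀ m n, I (m + 1) ≤ n →
      ({a | Nat.log 2 a = n ∧ P m a} ∩ Set.Ico (2 ^ n) (2 ^ (n + 1))).ncard * 2 ^ m ≤ 2 ^ n := by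
    intro m n hn
    refine ncard_dyadic_mul_le (P := P m) hn (by simpa only [P, hIsucc] using hsmall m (I m)) ?_
    rintro a ⟨-, w, hw, h⟩ - -
    refine ⟨w, hw, fun j h1 h2 => ?_⟩
    rw [h j h1 h2, Nat.testBit_mod_two_pow]
    simp [h2]
  -- The ranges for `Nat.log 2 a` overlap: a number of given length may be tested on either of two
  -- complete intervals, so the density bound only doubles.
  refine ⟨{a | ∃ m, I (m + 1) ≤ Nat.log 2 a ∧ Nat.log 2 a < I (m + 3) ∧ P m a}, ?_, ?_⟩
  · refine mem_densityZeroIdeal_of_dyadic fun K => ?_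
    filter_upwards [eventually_ge_atTop (I (K + 3))] with n hn
    obtain ⟨m, hm, hm'⟩ := (hI.comp (strictMono_id.add_const 2)).exists_le_lt_succ
      ((hI.le_iff_le.2 (by omega : 0 + 2 ≤ K + 3)).trans hn)
    replace hm : I (m + 2) ≤ n := hm
    replace hm' : n < I (m + 3) := hm'
    have hKm : K < m := by
      by_contra hcon
      exact absurd (lt_of_lt_of_le hm' (le_trans (hIle _ _ (by omega)) hn)) (lt_irrefl _)
    have hsub : {a | ∃ m, I (m + 1) ≤ Nat.log 2 a ∧ Nat.log 2 a < I (m + 3) ∧ P m a} ∩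
        Set.Ico (2 ^ n) (2 ^ (n + 1)) ⊆
        ({a | Nat.log 2 a = n ∧ P m a} ∩ Set.Ico (2 ^ n) (2 ^ (n + 1))) ∪
        ({a | Nat.log 2 a = n ∧ P (m + 1) a} ∩ Set.Ico (2 ^ n) (2 ^ (n + 1))) := by
      rintro a ⟨⟨m', h1, h2, h3⟩, ha⟩
      have hlog := log_eq_of_mem_Ico ha
      rw [hlog] at h1 h2
      have h4 : m' + 1 < m + 3 := hI.lt_iff_lt.1 (h1.trans_lt hm')
      have h5 : m + 2 < m' + 3 := hI.lt_iff_lt.1 (hm.trans_lt h2)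
      obtain rfl | rfl : m' = m ∨ m' = m + 1 := by omega
      · exact Or.inl ⟨⟨hlog, h3⟩, ha⟩
      · exact Or.inr ⟨⟨hlog, h3⟩, ha⟩
    have h1 := (Set.ncard_le_ncard hsub (((Set.finite_Ico _ _).inter_of_right _).union
      ((Set.finite_Ico _ _).inter_of_right _))).trans (Set.ncard_union_le _ _)
    have h2 := hPsmall m n (le_trans (hIle _ _ (by omega)) hm)
    have h3 := hPsmall (m + 1) n hm
    have h4 : 2 ^ K * 2 ≤ 2 ^ m := by
      rw [← pow_succ]; exact Nat.pow_le_pow_right two_pos hKm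
    have h5 : 2 ^ K * 2 ≤ 2 ^ (m + 1) := by
      rw [← pow_succ]; exact Nat.pow_le_pow_right two_pos (by omega)
    have h6 := (Nat.mul_le_mul_left _ h4).trans h2
    have h7 := (Nat.mul_le_mul_left _ h5).trans h3
    have h8 := Nat.mul_le_mul_right (2 ^ K * 2) h1
    rw [add_mul] at h8
    refine Nat.le_of_mul_le_mul_right (c := 2) ?_ two_pos
    rw [mul_assoc]
    omega
  · intro a x y ha hx hy
    obtain ⟨p, hp⟩ := Set.mem_iUnion.1 (hCF hx)
    obtain ⟨q, hq⟩ := Set.mem_iUnion.1 (hCF hy)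
    filter_upwards [eventually_ge_atTop (I (p + q + 3))] with k hk
    set n := Nat.log 2 (a (k + 1)) with hn
    have hkn : I (p + q + 3) ≤ n := hk.trans ((Nat.le_succ k).trans ha.strictMono.le_apply)
    obtain ⟨m, hm, hm'⟩ := (hI.comp (strictMono_id.add_const 2)).exists_le_lt_succ
      ((hI.le_iff_le.2 (by omega : 0 + 2 ≤ p + q + 3)).trans hkn)
    replace hm : I (m + 2) ≤ n := hm
    replace hm' : n < I (m + 3) := hm'
    have hKm : p + q < m := by
      by_contra hcon
      exact absurd (lt_of_lt_of_le hm' (le_trans (hIle _ _ (by omega)) hkn)) (lt_irrefl _)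
    -- If the cut is at or before `I (m + 1)`, the interval after that point carries digits of `x`;
    -- otherwise the interval before it carries digits of `y`.
    rcases le_total (Nat.log 2 (a k)) (I (m + 1)) with hle | hle
    · refine ⟨m + 1, hm, hm'.trans_le (hIle _ (m + 1 + 3) (by omega)), x, ?_, fun j h1 h2 => ?_⟩
      · exact Set.mem_biUnion (by simp only [Set.mem_Iic]; omega) hp
      · exact (ha.eq_tail k j (hle.trans h1) (h2.trans_le hm)).symm
    · refine ⟨m, le_trans (hIle _ _ (by omega)) hm, hm', y, ?_, fun j h1 h2 => ?_⟩
      · exact Set.mem_biUnion (by simp only [Set.mem_Iic]; omega) hq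
      · exact (ha.eq_limit k j (h2.trans_le hle)).symm

/-! ### Growth bounds -/

/-- An eventual bound on the growth of a convergent sequence yields a density zero set that the
sequence meets infinitely often. -/
theorem exists_mem_densityZeroIdeal_of_growth (g : ℕ → ℕ) :
    ∃ Z ∈ densityZeroIdeal, ∀ a x y, ConvergentSeq a x y →
      (∀ᶠ i in atTop, Nat.log 2 (a (i + 1)) < g i) → ∃ᶠ k in atTop, a k ∈ Z := by
  obtain ⟨I, hI0, hIsucc⟩ : ∃ I : ℕ → ℕ, I 0 = 0 ∧ ∀ m, I (m + 1) = max (g (I m)) (I m + 1) :=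
    ⟨fun m => Nat.rec 0 (fun _ i => max (g i) (i + 1)) m, rfl, fun _ => rfl⟩
  have hI : StrictMono I := strictMono_nat_of_lt_succ fun m => by rw [hIsucc]; omega
  -- The index `m` of the interval itself encodes the guess: its digits below the leading one. Every
  -- finite pattern is encoded by some `m`, and guesses lengthen with `m`.
  refine ⟨{a | ∃ m, I m ≤ Nat.log 2 a ∧ Nat.log 2 a < I (m + 1) ∧
    ∀ j < Nat.log 2 m, a.testBit j = m.testBit j}, ?_, ?_⟩
  · refine mem_densityZeroIdeal_of_dyadic fun K => ?_
    filter_upwards [eventually_ge_atTop (I (2 ^ K)), eventually_ge_atTop K] with n hn hKn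
    obtain ⟨m, hm, hm'⟩ := hI.exists_le_lt_succ (hI0.trans_le (Nat.zero_le n))
    have hKm : 2 ^ K ≤ m := Nat.lt_succ_iff.1 (hI.lt_iff_lt.1 (hn.trans_lt hm'))
    refine ncard_dyadic_testBit_le hKn (fun j => m.testBit j) ?_
    rintro a ⟨m', h1, h2, h3⟩ rfl j hj
    have h4 := hI.lt_iff_lt.1 (h1.trans_lt hm')
    have h5 := hI.lt_iff_lt.1 (hm.trans_lt h2)
    obtain rfl : m' = m := by omega
    exact h3 j (hj.trans_le (Nat.le_log_of_pow_le one_lt_two hKm))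
  · intro a x y ha hg
    refine frequently_atTop.2 fun N => ?_
    obtain ⟨i₀, hi₀⟩ := eventually_atTop.1 hg
    set k := max i₀ N
    obtain ⟨r, hr, hry⟩ : ∃ r < 2 ^ k, ∀ j < k, r.testBit j = y j := exists_testBit_eq y k
    -- This `m` guesses the first `k` digits of `y`; the term with index `I m + 1` is long enough to
    -- agree with them, and `g` keeps its length below `I (m + 1)`.
    set m := 2 ^ k + r with hm
    have hlog : Nat.log 2 m = k := Nat.log_eq_of_pow_le_of_lt_pow (by omega)
      (by rw [pow_succ]; omega)
    have hkm : k ≤ I m := ((Nat.lt_two_pow_self (n := k)).le.trans (by omega)).trans hI.le_apply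
    have hIm : I m ≤ Nat.log 2 (a (I m)) := ha.strictMono.le_apply (x := I m)
    have hstep : Nat.log 2 (a (I m)) < Nat.log 2 (a (I m + 1)) := ha.strictMono (Nat.lt_succ_self _)
    refine ⟨I m + 1, by omega, m, by omega, ?_, fun j hj => ?_⟩
    · exact (hi₀ (I m) (by omega)).trans_le (hIsucc m ▸ le_max_left _ _)
    · rw [hlog] at hj
      rw [ha.eq_limit _ j (by omega), hm, Nat.testBit_two_pow_add_gt hj, hry j hj]

/-! ### Guessing low digits -/

/-- The numbers whose binary digits at the places `j` with `h j ≤ log₂ a` agree with `z`. -/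
def guessSet (h : ℕ → ℕ) (z : ℕ → Bool) : Set ℕ :=
  {a | ∀ j < Nat.log 2 a, h j ≤ Nat.log 2 a → a.testBit j = z (Nat.pair j (Nat.log 2 a))}

/-- For fixed `K`, once `n` exceeds all `h j` with `j < K`, the first `K` digits of members of
length `n` are prescribed by `z` and `n`. -/
theorem guessSet_mem_densityZeroIdeal (h : ℕ → ℕ) (z : ℕ → Bool) :
    guessSet h z ∈ densityZeroIdeal := by
  refine mem_densityZeroIdeal_of_dyadic fun K => ?_
  have h1 : ∀ᶠ n in atTop, ∀ j ∈ Set.Iio K, h j ≤ n :=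
    (Set.finite_Iio K).eventually_all.2 fun j _ => eventually_ge_atTop (h j)
  filter_upwards [h1, eventually_ge_atTop K] with n hn hKn
  refine ncard_dyadic_testBit_le hKn (fun j => z (Nat.pair j n)) ?_
  rintro a ha rfl j hj
  exact ha j (hj.trans_le hKn) (hn j hj)

/-- For fixed `k`, guessing `k` digits correctly at stage `i` has probability `2⁻¹ ^ k`. Injectivity
of `D` makes the stages use disjoint coordinates, hence independent. By the second Borel–Cantelli
lemma, failing at all stages from `N` on is null; it is also a closed condition. -/
theorem setOf_eventually_ne_mem_closedNullIdeal {D : ℕ → ℕ} (hD : Function.Injective D)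
    (b : ℕ → ℕ → Bool) :
    {z : ℕ → Bool | ∃ k, ∀ᶠ i in atTop, ∃ j < k, b i j ≠ z (Nat.pair j (D i))} ∈
      closedNullIdeal := by
  let c : ℕ → Bool := fun p => Function.extend D b (fun _ _ => false) p.unpair.2 p.unpair.1
  have hc : ∀ i j, c (Nat.pair j (D i)) = b i j := fun i j => by
    simp only [c, Nat.unpair_pair, hD.extend_apply]
  let T : ℕ → ℕ → Finset ℕ := fun k i => (Finset.range k).image fun j => Nat.pair j (D i)
  let s : ℕ → ℕ → Set (ℕ → Bool) := fun k i => Set.pi (T k i : Set ℕ) fun p => {c p}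
  have hopen : ∀ k i, IsOpen (s k i) := fun k i => isOpen_pi_singleton _ c
  have hs : ∀ k i z, z ∈ s k i ↔ ∀ j < k, z (Nat.pair j (D i)) = b i j := by
    intro k i z
    simp [s, T, Set.mem_pi, hc]
  have hcard : ∀ k i, (T k i).card = k := fun k i => by
    rw [Finset.card_image_of_injective _ fun j j' h => (Nat.pair_eq_pair.1 h).1, Finset.card_range]
  have hmeas : ∀ k i, coinMeasure (s k i) = 2⁻¹ ^ k := fun k i => by
    rw [coinMeasure_pi_singleton, hcard]
  have hindep : ∀ k, ProbabilityTheory.iIndepSet (s k) coinMeasure := by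
    intro k
    refine (ProbabilityTheory.iIndepSet_iff_meas_biInter fun i => (hopen k i).measurableSet).2
      fun t => ?_
    have : ⋂ i ∈ t, s k i = Set.pi ((t.biUnion (T k) : Finset ℕ) : Set ℕ) fun p => {c p} := by
      ext z
      simp only [s, Set.mem_iInter, Set.mem_pi, Finset.coe_biUnion, Set.mem_iUnion,
        Finset.mem_coe, exists_prop, forall_exists_index, and_imp]
      exact ⟨fun h p i hi hp => h i hi p hp, fun h i hi p hp => h p i hi hp⟩
    rw [this, coinMeasure_pi_singleton, Finset.card_biUnion]
    · simp only [hmeas, hcard, Finset.sum_const, Finset.prod_const, smul_eq_mul]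
      rw [mul_comm, pow_mul]
    · intro i _ i' _ hii
      refine Finset.disjoint_left.2 fun p hp hp' => hii ?_
      simp only [T, Finset.mem_image] at hp hp'
      obtain ⟨j, -, rfl⟩ := hp
      obtain ⟨j', -, h⟩ := hp'
      exact (hD (Nat.pair_eq_pair.1 h).2).symm
  refine ⟨fun e => ⋂ i ∈ Set.Ici e.unpair.2, (s e.unpair.1 i)ᶜ, fun e => ⟨?_, ?_⟩, ?_⟩
  · exact isClosed_biInter fun i _ => (hopen _ i).isClosed_compl
  · have hone := ProbabilityTheory.measure_limsup_eq_one
      (fun i => (hopen e.unpair.1 i).measurableSet) (hindep e.unpair.1) (by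
        simp only [hmeas]
        exact ENNReal.tsum_const_eq_top_of_ne_zero (pow_ne_zero _ (by simp)))
    refine measure_mono_null (t := (limsup (s e.unpair.1) atTop)ᶜ) ?_
      ((prob_compl_eq_zero_iff (MeasurableSet.measurableSet_limsup
        fun i => (hopen e.unpair.1 i).measurableSet)).2 hone)
    intro z hz hlim
    obtain ⟨i, hi, hzi⟩ := frequently_atTop.1 (Filter.mem_limsup_iff_frequently_mem.1 hlim)
      e.unpair.2
    exact Set.mem_iInter₂.1 hz i hi hzi
  · rintro z ⟨k, hk⟩
    obtain ⟨N, hN⟩ := eventually_atTop.1 hk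
    refine Set.mem_iUnion.2 ⟨Nat.pair k N, Set.mem_iInter₂.2 fun i hi hz => ?_⟩
    simp only [Nat.unpair_pair, Set.mem_Ici] at hi hz
    obtain ⟨j, hj, hne⟩ := hN i hi
    exact hne ((hs k i z).1 hz j hj).symm

/-- The set caught by the guesses of `z` is met infinitely often once `h` is not dominated by the
places where the guesses are right. -/
theorem exists_forall_frequently_mem_guessSet {a : ℕ → ℕ} {z : ℕ → Bool}
    (hz : ¬ ∃ k, ∀ᶠ i in atTop, ∃ j < k,
      (a i).testBit j ≠ z (Nat.pair j (Nat.log 2 (a i)))) :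
    ∃ f : ℕ → ℕ, ∀ h : ℕ → ℕ, Monotone h → (∃ᶠ k in atTop, f k < h k) →
      ∃ᶠ i in atTop, a i ∈ guessSet h z := by
  have hex : ∀ k, ∃ i ≥ k, ∀ j < k, (a i).testBit j = z (Nat.pair j (Nat.log 2 (a i))) := by
    intro k
    by_contra! hcon
    exact hz ⟨k, eventually_atTop.2 ⟨k, hcon⟩⟩
  choose i hik hi using hex
  -- If `f k < h k`, monotonicity lets only places `j < k` satisfy `h j ≤ f k`, and there the
  -- guesses for `a (i k)` are right.
  refine ⟨fun k => Nat.log 2 (a (i k)), fun h hmono hfreq => ?_⟩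
  refine frequently_atTop.2 fun N => ?_
  obtain ⟨k, hNk, hk⟩ := frequently_atTop.1 hfreq N
  refine ⟨i k, le_trans hNk (hik k), fun j _ hj => hi k j ?_⟩
  by_contra! hkj
  exact absurd (hj.trans_lt hk) (not_lt.2 (hmono hkj))

/-! ### Closure properties of the ideal -/

theorem biUnion_mem_closedNullIdeal {ι : Type*} {s : Set ι} (hs : s.Countable)
    {f : ι → Set (ℕ → Bool)} (hf : ∀ i ∈ s, f i ∈ closedNullIdeal) :
    ⋃ i ∈ s, f i ∈ closedNullIdeal := by
  rcases s.eq_empty_or_nonempty with rfl | hne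
  · exact ⟨fun _ => ∅, fun _ => ⟨isClosed_empty, measure_empty⟩, by simp⟩
  obtain ⟨e, rfl⟩ := hs.exists_eq_range hne
  choose F hF hsub using fun n => hf (e n) ⟨n, rfl⟩
  refine ⟨fun p => F p.unpair.1 p.unpair.2, fun p => hF _ _, ?_⟩
  rw [Set.biUnion_range]
  refine Set.iUnion_subset fun n z hz => ?_
  obtain ⟨m, hm⟩ := Set.mem_iUnion.1 (hsub n hz)
  exact Set.mem_iUnion.2 ⟨Nat.pair n m, by simpa only [Nat.unpair_pair] using hm⟩

theorem union_mem_closedNullIdeal {A B : Set (ℕ → Bool)} (hA : A ∈ closedNullIdeal)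
    (hB : B ∈ closedNullIdeal) : A ∪ B ∈ closedNullIdeal := by
  have h := biUnion_mem_closedNullIdeal (Set.countable_univ (α := Bool))
    (f := fun b => cond b A B) (by rintro (_ | _) - <;> assumption)
  simpa [Set.union_eq_iUnion] using h

theorem Set.Countable.mem_closedNullIdeal {A : Set (ℕ → Bool)} (hA : A.Countable) :
    A ∈ closedNullIdeal := by
  have h := biUnion_mem_closedNullIdeal hA (f := fun x => {x}) fun x _ =>
    ⟨fun _ => {x}, fun _ => ⟨isClosed_singleton, coinMeasure_singleton x⟩,
      fun y hy => Set.mem_iUnion.2 ⟨0, hy⟩⟩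
  rwa [Set.biUnion_of_singleton] at h

theorem univ_notMem_closedNullIdeal : Set.univ ∉ closedNullIdeal := by
  rintro ⟨F, hF, hA⟩
  obtain ⟨A, hA'⟩ := exists_not_mem_closedNullIdeal
  exact hA' ⟨F, hF, (Set.subset_univ A).trans hA⟩

theorem infinite_inter_of_frequently {a : ℕ → ℕ} (ha : StrictMono fun k => Nat.log 2 (a k))
    {A Z : Set ℕ} (hA : ∀ k, a k ∈ A) (hZ : ∃ᶠ k in atTop, a k ∈ Z) : (A ∩ Z).Infinite := by
  have hinj : Function.Injective a := Function.Injective.of_comp (f := Nat.log 2) ha.injective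
  refine ((Nat.frequently_atTop_iff_infinite.1 hZ).image hinj.injOn).mono ?_
  rintro _ ⟨k, hk, rfl⟩
  exact ⟨hA k, hk⟩

/-! ### What a witness for `non*(𝒵)` provides -/

section Witness

variable {𝒜 : Set (Set ℕ)} {a : Set ℕ → ℕ → ℕ} {x y : Set ℕ → ℕ → Bool}

/-- The digit sequences of the members of a witness for `non*(𝒵)` do not form a set in `ℰ`. -/
theorem image_union_image_notMem_closedNullIdeal (hmem : ∀ A ∈ 𝒜, ∀ k, a A k ∈ A)
    (hconv : ∀ A ∈ 𝒜, ConvergentSeq (a A) (x A) (y A))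
    (hmeet : ∀ B ∈ densityZeroIdeal, ∃ A ∈ 𝒜, (A ∩ B).Finite) :
    x '' 𝒜 ∪ y '' 𝒜 ∉ closedNullIdeal := by
  intro hX
  obtain ⟨Z, hZ, hcatch⟩ := exists_mem_densityZeroIdeal_of_mem_closedNullIdeal hX
  obtain ⟨A, hA, hfin⟩ := hmeet Z hZ
  have h := hcatch _ _ _ (hconv A hA) (Or.inl ⟨A, hA, rfl⟩) (Or.inr ⟨A, hA, rfl⟩)
  refine infinite_inter_of_frequently (hconv A hA).strictMono (hmem A hA) ?_ hfin
  exact ((tendsto_add_atTop_nat 1).frequently h.frequently)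

/-- The growth functions of the members of a witness for `non*(𝒵)` are unbounded. -/
theorem exists_frequently_lt_log (hmem : ∀ A ∈ 𝒜, ∀ k, a A k ∈ A)
    (hconv : ∀ A ∈ 𝒜, ConvergentSeq (a A) (x A) (y A))
    (hmeet : ∀ B ∈ densityZeroIdeal, ∃ A ∈ 𝒜, (A ∩ B).Finite) (f : ℕ → ℕ) :
    ∃ A ∈ 𝒜, ∃ᶠ k in atTop, f k < Nat.log 2 (a A (k + 1)) := by
  obtain ⟨Z, hZ, hcatch⟩ := exists_mem_densityZeroIdeal_of_growth fun k => f k + 1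
  obtain ⟨A, hA, hfin⟩ := hmeet Z hZ
  refine ⟨A, hA, fun hev => ?_⟩
  refine infinite_inter_of_frequently (hconv A hA).strictMono (hmem A hA) ?_ hfin
  exact hcatch _ _ _ (hconv A hA) (hev.mono fun k hk => Nat.lt_succ_of_le (not_lt.1 hk))

theorem aleph0_le_mk_of_notMem_closedNullIdeal
    (hX : x '' 𝒜 ∪ y '' 𝒜 ∉ closedNullIdeal) : ℵ₀ ≤ #𝒜 := by
  rw [← not_lt, Cardinal.lt_aleph0_iff_set_finite]
  exact fun hfin => hX ((hfin.image x).union (hfin.image y)).countable.mem_closedNullIdeal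

theorem mk_image_union_image_le (h𝒜 : ℵ₀ ≤ #𝒜) : #↥(x '' 𝒜 ∪ y '' 𝒜) ≤ #𝒜 :=
  (mk_union_le _ _).trans ((add_le_add mk_image_le mk_image_le).trans (add_eq_self h𝒜).le)

end Witness

/-! ### The three inequalities -/

theorem nonNumber_closedNullIdeal_le : nonNumber closedNullIdeal ≤ nonStar densityZeroIdeal := by
  obtain ⟨𝒜₀, h₀, h₀'⟩ := exists_nonStar_witness
  refine le_csInf ⟨_, 𝒜₀, h₀, h₀', rfl⟩ ?_
  rintro _ ⟨𝒜, hinf, hmeet, rfl⟩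
  choose! a x y hmem hconv using fun A (hA : A ∈ 𝒜) => (hinf A hA).exists_convergentSeq
  have hX := image_union_image_notMem_closedNullIdeal hmem hconv hmeet
  exact le_trans (csInf_le' ⟨_, hX, rfl⟩)
    (mk_image_union_image_le (aleph0_le_mk_of_notMem_closedNullIdeal hX))

theorem covStar_densityZeroIdeal_le_covNumber :
    covStar densityZeroIdeal ≤ covNumber closedNullIdeal := by
  obtain ⟨𝒞₀, h₀, h₀'⟩ := exists_cover_closedNullIdeal
  refine le_csInf ⟨_, 𝒞₀, h₀, h₀', rfl⟩ ?_
  rintro _ ⟨𝒞, h𝒞, hcov, rfl⟩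
  have hinf : ℵ₀ ≤ #𝒞 := by
    rw [← not_lt, Cardinal.lt_aleph0_iff_set_finite]
    intro hfin
    refine univ_notMem_closedNullIdeal ?_
    rw [← hcov, Set.sUnion_eq_biUnion]
    exact biUnion_mem_closedNullIdeal hfin.countable fun C hC => h𝒞 hC
  choose! Z hZ hcatch using fun C (hC : C ∈ closedNullIdeal) =>
    exists_mem_densityZeroIdeal_of_mem_closedNullIdeal hC
  -- Pairs are needed because `x` and `y` may be covered by different members of `𝒞`.
  have hle : #↥(Set.image2 (fun C C' => Z (C ∪ C')) 𝒞 𝒞) ≤ #𝒞 :=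
    mk_image2_le.trans (mul_eq_self hinf).le
  refine le_trans (csInf_le' ⟨_, ?_, fun B hB => ?_, rfl⟩) hle
  · rintro _ ⟨C, hC, C', hC', rfl⟩
    exact hZ _ (union_mem_closedNullIdeal (h𝒞 hC) (h𝒞 hC'))
  · obtain ⟨a, x, y, hmem, hconv⟩ := hB.exists_convergentSeq
    obtain ⟨C, hC, hx⟩ := Set.mem_sUnion.1 (hcov.symm ▸ Set.mem_univ x)
    obtain ⟨C', hC', hy⟩ := Set.mem_sUnion.1 (hcov.symm ▸ Set.mem_univ y)
    refine ⟨_, ⟨C, hC, C', hC', rfl⟩, ?_⟩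
    rw [Set.inter_comm]
    have h := hcatch _ (union_mem_closedNullIdeal (h𝒞 hC) (h𝒞 hC')) a x y hconv
      (Or.inl hx) (Or.inr hy)
    exact infinite_inter_of_frequently hconv.strictMono hmem
      ((tendsto_add_atTop_nat 1).frequently h.frequently)

theorem covStar_densityZeroIdeal_le_nonStar :
    covStar densityZeroIdeal ≤ nonStar densityZeroIdeal := by
  obtain ⟨𝒜₀, h₀, h₀'⟩ := exists_nonStar_witness
  refine le_csInf ⟨_, 𝒜₀, h₀, h₀', rfl⟩ ?_
  rintro _ ⟨𝒜, hinf, hmeet, rfl⟩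
  choose! a x y hmem hconv using fun A (hA : A ∈ 𝒜) => (hinf A hA).exists_convergentSeq
  have hX := image_union_image_notMem_closedNullIdeal hmem hconv hmeet
  have h𝒜 := aleph0_le_mk_of_notMem_closedNullIdeal hX
  have hle : #↥(Set.image2 (fun A z => guessSet (fun k => Nat.log 2 (a A (k + 1))) z) 𝒜
      (x '' 𝒜 ∪ y '' 𝒜)) ≤ #𝒜 :=
    mk_image2_le.trans ((mul_le_mul_right (mk_image_union_image_le h𝒜) _).trans
      (mul_eq_self h𝒜).le)
  refine le_trans (csInf_le' ⟨_, ?_, fun B hB => ?_, rfl⟩) hle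
  · rintro _ ⟨A, -, z, -, rfl⟩
    exact guessSet_mem_densityZeroIdeal _ z
  · obtain ⟨b, u, v, hb, hbconv⟩ := hB.exists_convergentSeq
    have hE := setOf_eventually_ne_mem_closedNullIdeal hbconv.strictMono.injective
      fun i j => (b i).testBit j
    obtain ⟨z, hz, hzE⟩ : ∃ z ∈ x '' 𝒜 ∪ y '' 𝒜, z ∉ {z : ℕ → Bool | ∃ k, ∀ᶠ i in atTop,
        ∃ j < k, (b i).testBit j ≠ z (Nat.pair j (Nat.log 2 (b i)))} := by
      by_contra! hcon
      obtain ⟨F, hF, hsub⟩ := hE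
      exact hX ⟨F, hF, fun z hz => hsub (hcon z hz)⟩
    obtain ⟨f, hf⟩ := exists_forall_frequently_mem_guessSet hzE
    -- The growth function is chosen only after `z` has determined `f`, so all pairs `(A, z)` enter
    -- the family.
    obtain ⟨A, hA, hfreq⟩ := exists_frequently_lt_log hmem hconv hmeet f
    refine ⟨_, ⟨A, hA, z, hz, rfl⟩, ?_⟩
    rw [Set.inter_comm]
    refine infinite_inter_of_frequently hbconv.strictMono hb (hf _ ?_ hfreq)
    exact fun k l hkl => (hconv A hA).strictMono.monotone (Nat.succ_le_succ hkl)

theorem mainTheorem5 :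
    nonNumber closedNullIdeal ≤ nonStar densityZeroIdeal ∧
    covStar densityZeroIdeal ≤ covNumber closedNullIdeal ∧
    covStar densityZeroIdeal ≤ nonStar densityZeroIdeal :=
  ⟨nonNumber_closedNullIdeal_le, covStar_densityZeroIdeal_le_covNumber,
    covStar_densityZeroIdeal_le_nonStar⟩
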